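/- Let $N\ge 1$, let $[x_k]=(x_0,\dots,x_N)$ be a nonsingular Gaussian sequence of $\mathbb{R}^d$-valued random vectors (that is, $x_0,\dots,x_N$ are jointly Gaussian, with arbitrary mean, and the covariance matrix $C$ of the whole sequence, with $d\times d$ blocks $\operatorname{Cov}(x_k,x_l)$, is nonsingular), and let $k_1\in\{0,1,\dots,N-1\}$. For $0\le a<b\le N$ and $c\in\{a,b\}$ the sequence is called $[a,b]$-$CM_c$ if $$F(\xi\mid x_a,x_{a+1},\dots,x_j,x_c)=F(\xi\mid x_j,x_c)\quad\text{almost surely}$$ for all $j<k$ in $\{a,\dots,b\}$ and all $\xi\in\mathbb{R}^d$, where $F(\xi\mid\cdot)$ is the conditional distribution function of $x_k$. It is $[a,b]$-$CM_F$ if this holds with $c=a$ and $[a,b]$-$CM_L$ if it holds with $c=b$; $CM_L$ means $[0,N]$-$CM_L$. Then $[x_k]$ is both $CM_L$ and $[k_1,N]$-$CM_F$ if and only if there are real $d\times d$ matrices $A_0,\dots,A_N$, $B_0,\dots,B_{N-1}$, $D_0,\dots,D_{N-2}$ such that $$C^{-1}=\begin{bmatrix} A_0 & B_0 & 0 & \cdots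 & 0 & 0 & D_0\\ B_0' & A_1 & B_1 & 0 & \cdots & 0 & D_1\\ 0 & B_1' & A_2 & B_2 & \cdots & 0 & D_2\\ \vdots & \vdots & \vdots & \vdots & \vdots & \vdots & \vdots\\ 0 & \cdots & 0 & B_{N-3}' & A_{N-2} & B_{N-2} & D_{N-2}\\ 0 & \cdots & 0 & 0 & B_{N-2}' & A_{N-1} & B_{N-1}\\ D_0' & D_1' & D_2' & \cdots & D_{N-2}' & B_{N-1}' & A_N \end{bmatrix}$$ (where $'$ denotes transpose) and $D_{k_1+1}=D_{k_1+2}=\cdots=D_{N-2}=0$. (The last condition is empty if $k_1\ge N-2$.) -/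

import Mathlib

open MeasureTheory ProbabilityTheory

namespace CMSequence

variable {Ω : Type*} [MeasurableSpace Ω] {N d : ℕ}

/-- The σ-algebra generated by the family `[x_i]`, `i ∈ S`. -/
@[reducible] def sigmaOf (x : Fin (N + 1) → Ω → (Fin d → ℝ)) (S : Set (Fin (N + 1))) : MeasurableSpace Ω :=
  ⨆ i ∈ S, MeasurableSpace.comap (x i) inferInstance

/-- `[x_k]` is `[k₁,k₂]`-`CM_c`: for all `j < k` in `[k₁,k₂]` and every `ξ ∈ ℝ^d`,
`F(ξ | [x_i]_{k₁}^{j}, x_c) = F(ξ | x_j, x_c)` almost surely, where `F(ξ | ·)` is the conditional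
distribution function of `x_k`, that is, the conditional probability of the event
`x_k ≤ ξ` (componentwise). -/
def IsCM (P : Measure Ω) (x : Fin (N + 1) → Ω → (Fin d → ℝ)) (k₁ k₂ c : Fin (N + 1)) : Prop :=
  ∀ j k : Fin (N + 1), k₁ ≤ j → j < k → k ≤ k₂ → ∀ ξ : Fin d → ℝ,
    P⟦{ω | x k ω ≤ ξ} | sigmaOf x (Set.Icc k₁ j ∪ {c})⟧
      =ᵐ[P] P⟦{ω | x k ω ≤ ξ} | sigmaOf x {j, c}⟧

/-- `[k₁,k₂]`-`CM_F`: the conditioning is at the first time of the CM interval. -/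
def IsCMF (P : Measure Ω) (x : Fin (N + 1) → Ω → (Fin d → ℝ)) (k₁ k₂ : Fin (N + 1)) : Prop :=
  IsCM P x k₁ k₂ k₁

/-- `[k₁,k₂]`-`CM_L`: the conditioning is at the last time of the CM interval. -/
def IsCML (P : Measure Ω) (x : Fin (N + 1) → Ω → (Fin d → ℝ)) (k₁ k₂ : Fin (N + 1)) : Prop :=
  IsCM P x k₁ k₂ k₂

/-- The covariance matrix of the whole sequence; its `(k, l)` block is `Cov(x_k, x_l)`. -/
noncomputable def covMatrix (P : Measure Ω) (x : Fin (N + 1) → Ω → (Fin d → ℝ)) :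
    Matrix (Fin (N + 1) × Fin d) (Fin (N + 1) × Fin d) ℝ :=
  Matrix.of fun p q => cov[fun ω => x p.1 ω p.2, fun ω => x q.1 ω q.2; P]

/-- A nonsingular Gaussian sequence: the random vectors `x_0, …, x_N` are jointly Gaussian and the
covariance matrix of the whole sequence is nonsingular. -/
structure IsNonsingularGaussian (P : Measure Ω) (x : Fin (N + 1) → Ω → (Fin d → ℝ)) : Prop where
  measurable : ∀ k, Measurable (x k)
  gaussian : HasGaussianLaw (fun ω k => x k ω) P
  nonsingular : IsUnit (covMatrix P x).det

/-- The block matrix with diagonal blocks `A_0, …, A_N`, superdiagonal blocks `B_0, …, B_{N-1}`,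
last block column `D_0, …, D_{N-2}, B_{N-1}, A_N`, transposed blocks below the diagonal, and zero
blocks elsewhere. (The entries of `A`, `B`, `D` beyond these ranges are not used.) -/
def cmLForm (N : ℕ) (A B D : ℕ → Matrix (Fin d) (Fin d) ℝ) :
    Matrix (Fin (N + 1)) (Fin (N + 1)) (Matrix (Fin d) (Fin d) ℝ) :=
  Matrix.of fun i j =>
    if i.val = j.val then A i
    else if j.val = i.val + 1 then B i
    else if i.val = j.val + 1 then (B j).transpose
    else if j.val = N then D i
    else if i.val = N then (D j).transpose
    else 0

end CMSequence

/-! For a Gaussian sequence, a conditional law of $x_k$ is a fixed residual law translated by a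
linear regression. So discarding part of the conditioning is harmless exactly when the regression
does not use it (`condExp_eq_iff_isExplained`). Split the indices into past $P$, conditioning set
$J$ and future $F$. The condition then says that the past is conditionally independent of the future
given $J$, which amounts to zero blocks of $C^{-1}$ between $P$ and $F$.

For $CM_L$, with $J=\{j,N\}$, this kills every block $(i,k)$ with $i<j<k<N$ and leaves the bordered
tridiagonal form. For $[k_1,N]$-$CM_F$ the times $O$ before $k_1$ must first be marginalised, which
in general changes the inverse covariance. Here $CM_L$ already makes the blocks between $O$ and $P$
zero, so the entries between $P$ and $F$ survive unchanged. Now $F$ contains $N$, and the new zeros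
are the blocks $D_i$ with $k_1<i\le N-2$. -/

namespace CMSequence

/-! ### Regression coefficients and zeros of the inverse matrix -/

section LinearAlgebra

open Matrix

variable {ι : Type*} [Fintype ι]

/-- A vector supported on `S` whose image under a positive definite matrix vanishes on `S` is zero. -/
lemma eq_zero_of_support_of_mulVec_eq_zero {C : Matrix ι ι ℝ} (hC : C.PosDef) {S : Set ι}
    {u : ι → ℝ} (hu : ∀ q ∉ S, u q = 0) (hCu : ∀ q ∈ S, (C *ᵥ u) q = 0) : u = 0 := by
  by_contra hne
  have h := hC.dotProduct_mulVec_pos hne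
  refine h.ne' (Finset.sum_eq_zero fun q _ => ?_)
  by_cases hq : q ∈ S
  · rw [hCu q hq, mul_zero]
  · simp [hu q hq]

/-- Projection, in the inner product given by a positive definite matrix, onto the vectors
supported on `S`. -/
lemma exists_projection {C : Matrix ι ι ℝ} (hC : C.PosDef) (S : Set ι) (u : ι → ℝ) :
    ∃ s : ι → ℝ, (∀ q ∉ S, s q = 0) ∧ ∀ q ∈ S, (C *ᵥ (u - s)) q = 0 := by
  classical
  let D : Matrix S S ℝ := C.submatrix Subtype.val Subtype.val
  let ext : (S → ℝ) → ι → ℝ := fun v q => if hq : q ∈ S then v ⟨q, hq⟩ else 0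
  have hext : ∀ v : S → ℝ, ∀ q : S, (C *ᵥ ext v) q = (D *ᵥ v) q := by
    intro v q
    simp only [mulVec, dotProduct, D, submatrix_apply]
    rw [← Finset.sum_subset (Finset.subset_univ (Finset.univ.filter (· ∈ S)))]
    · rw [Finset.sum_subtype (p := (· ∈ S)) _ (by simp)]
      exact Finset.sum_congr rfl fun i _ => by simp [ext]
    · intro i _ hi
      have hi : i ∉ S := by simpa using hi
      simp [ext, hi]
  have hinj : Function.Injective (D.mulVecLin) := by
    refine (injective_iff_map_eq_zero _).2 fun v hv => ?_
    have h0 : ext v = 0 := eq_zero_of_support_of_mulVec_eq_zero hC (S := S)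
      (fun q hq => by simp [ext, hq]) fun q hq => by
        rw [hext v ⟨q, hq⟩]
        exact congrFun hv _
    funext q
    have := congrFun h0 q
    simpa [ext] using this
  obtain ⟨v, hv⟩ := (LinearMap.injective_iff_surjective.1 hinj) fun q : S => (C *ᵥ u) q
  refine ⟨ext v, fun q hq => by simp [ext, hq], fun q hq => ?_⟩
  have h1 : (D *ᵥ v) ⟨q, hq⟩ = (C *ᵥ u) q := congrFun hv ⟨q, hq⟩
  rw [mulVec_sub, Pi.sub_apply, hext v ⟨q, hq⟩, h1, sub_self]

/-- `e_p` is a combination of the `e_q`, `q ∈ T`, up to a vector that is orthogonal to the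
`e_q`, `q ∈ S`, in the inner product given by `C`. -/
def IsExplained [DecidableEq ι] (C : Matrix ι ι ℝ) (S T : Set ι) (p : ι) : Prop :=
  ∃ h : ι → ℝ, (∀ q ∉ T, h q = 0) ∧ ∀ q ∈ S, (C *ᵥ (Pi.single p 1 - h)) q = 0

lemma isExplained_of_mem [DecidableEq ι] (C : Matrix ι ι ℝ) (S : Set ι) {T : Set ι} {p : ι}
    (hp : p ∈ T) : IsExplained C S T p :=
  ⟨Pi.single p 1, fun q hq => Pi.single_eq_of_ne (by rintro rfl; exact hq hp) _, fun q _ => by simp⟩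

/-- Let $s$ be the projection of $e_p$ onto the vectors supported on $P\cup J$. Then $C(e_p-s)$
lives off $P\cup J$, where the rows of $C^{-1}$ indexed by $P$ vanish. Applying $C^{-1}$ shows that
$e_p-s$, hence $s$, is zero on $P$. -/
lemma isExplained_of_inv_eq_zero [DecidableEq ι] {C : Matrix ι ι ℝ} (hC : C.PosDef)
    {P J : Set ι} (h : ∀ p ∈ P, ∀ q, q ∉ P → q ∉ J → C⁻¹ p q = 0) {p : ι} (hp : p ∉ P) :
    IsExplained C (P ∪ J) J p := by
  obtain ⟨s, hs, hs'⟩ := exists_projection hC (P ∪ J) (Pi.single p 1)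
  refine ⟨s, fun q hq => ?_, hs'⟩
  by_cases hqP : q ∈ P
  · have hdet : IsUnit C.det := (isUnit_iff_isUnit_det C).1 hC.isUnit
    have h1 : (Pi.single p 1 - s : ι → ℝ) q
        = (C⁻¹ *ᵥ (C *ᵥ (Pi.single p 1 - s))) q := by
      rw [mulVec_mulVec, nonsing_inv_mul _ hdet, one_mulVec]
    have h2 : (C⁻¹ *ᵥ (C *ᵥ (Pi.single p 1 - s))) q = 0 := by
      refine Finset.sum_eq_zero fun r _ => ?_
      change C⁻¹ q r * _ = 0
      by_cases hr : r ∈ P ∪ J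
      · rw [hs' r hr, mul_zero]
      · rw [h q hqP r (fun h => hr (.inl h)) (fun h => hr (.inr h)), zero_mul]
    rw [h2, Pi.sub_apply, Pi.single_eq_of_ne (by rintro rfl; exact hp hqP)] at h1
    linarith
  · exact hs q (by simp [hqP, hq])

/-- Converse direction, with a set $O$ of indices outside the conditioning problem. The hypothesis
`hPO` ensures that marginalising $O$ leaves the entries between $P$ and $F$ unchanged. -/
lemma inv_eq_zero_of_isExplained [DecidableEq ι] {C : Matrix ι ι ℝ} (hC : C.PosDef)
    {O P J F : Set ι} (hcover : ∀ q, q ∈ O ∨ q ∈ P ∨ q ∈ J ∨ q ∈ F)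
    (hPJ : Disjoint P J) (hPF : Disjoint P F)
    (hOP : Disjoint O P) (hOJ : Disjoint O J) (hJF : Disjoint J F)
    (hPO : ∀ p ∈ P, ∀ q ∈ O, C⁻¹ p q = 0)
    (h : ∀ q ∈ F, IsExplained C (P ∪ J) J q) {p q : ι} (hp : p ∈ P) (hq : q ∈ F) :
    C⁻¹ p q = 0 := by
  classical
  choose! g hg hg' using h
  have hdet : IsUnit C.det := (isUnit_iff_isUnit_det C).1 hC.isUnit
  -- This choice makes $w$ vanish on $O$ while $Cw$ vanishes on $P\cup J$: $w$ is column $q$ of the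
  -- inverse of the covariance with $O$ marginalised, extended by zero.
  obtain ⟨z, hz, hz'⟩ := exists_projection hC.inv O (Pi.single q 1)
  set w : ι → ℝ := C⁻¹ *ᵥ (Pi.single q 1 - z) with hw
  have hCw : C *ᵥ w = Pi.single q 1 - z := by
    rw [hw, mulVec_mulVec, mul_nonsing_inv _ hdet, one_mulVec]
  let s : Finset ι := Finset.univ.filter (· ∈ F)
  -- Subtracting the residuals clears the $F$-coordinates of $w$. The remainder is supported on
  -- $P\cup J$ and $C$-orthogonal to it, hence zero. Since the $g_k$ live on $J$, nothing is left of
  -- $w$ on $P$.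
  have hr : w - ∑ k ∈ s, w k • (Pi.single k 1 - g k) = 0 := by
    refine eq_zero_of_support_of_mulVec_eq_zero hC (S := P ∪ J) (fun i hi => ?_) fun i hi => ?_
    · have hiP : i ∉ P := fun h => hi (.inl h)
      have hiJ : i ∉ J := fun h => hi (.inr h)
      have hgi : ∀ k ∈ s, g k i = 0 := fun k hk => hg k (by simpa [s] using hk) i hiJ
      rw [Pi.sub_apply, Finset.sum_apply, Finset.sum_congr rfl
        (g := fun k => if i = k then w k else 0) (fun k hk => by
          simp only [Pi.smul_apply, Pi.sub_apply, hgi k hk, sub_zero, smul_eq_mul,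
            Pi.single_apply, mul_ite, mul_one, mul_zero]), Finset.sum_ite_eq]
      by_cases hiF : i ∈ F
      · simp [s, hiF]
      · have hiO : i ∈ O := by
          rcases hcover i with h | h | h | h
          · exact h
          · exact absurd h hiP
          · exact absurd h hiJ
          · exact absurd h hiF
        have : w i = 0 := hz' i hiO
        simp [this]
    · have hiF : i ∉ F := by
        rcases hi with h | h
        · exact Set.disjoint_left.1 hPF h
        · exact Set.disjoint_left.1 hJF h
      have hiO : i ∉ O := by
        rcases hi with h | h
        · exact Set.disjoint_right.1 hOP h
        · exact Set.disjoint_right.1 hOJ h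
      rw [mulVec_sub, hCw, mulVec_sum, Pi.sub_apply, Finset.sum_apply, Pi.sub_apply, hz i hiO,
        Pi.single_eq_of_ne (by rintro rfl; exact hiF hq), Finset.sum_eq_zero, sub_zero, sub_zero]
      intro k hk
      rw [mulVec_smul, Pi.smul_apply, hg' k (by simpa [s] using hk) i hi, smul_zero]
  have hwp : w p = 0 := by
    have := congrFun (sub_eq_zero.1 hr) p
    rw [this, Finset.sum_apply]
    refine Finset.sum_eq_zero fun k hk => ?_
    have hkF : k ∈ F := by simpa [s] using hk
    rw [Pi.smul_apply, Pi.sub_apply, hg k hkF p (Set.disjoint_left.1 hPJ hp),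
      Pi.single_eq_of_ne (by rintro rfl; exact Set.disjoint_left.1 hPF hp hkF), sub_zero, smul_zero]
  rw [hw, mulVec_sub, Pi.sub_apply, mulVec_single_one, Matrix.col_apply] at hwp
  have : (C⁻¹ *ᵥ z) p = 0 := by
    refine Finset.sum_eq_zero fun r _ => ?_
    change C⁻¹ p r * z r = 0
    by_cases hr : r ∈ O
    · rw [hPO p hp r hr, zero_mul]
    · rw [hz r hr, mul_zero]
  linarith

end LinearAlgebra
-- Conditional probabilities under independence, and distribution functions
section Conditioning

/-- If `Y` is independent of `m` and `X` is `m`-measurable, then the conditional probability of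
`(X, Y) ∈ A` given `m` is obtained by freezing `X` and integrating over the law of `Y`. -/
lemma condExp_indicator_prod_of_indep {Ω E F : Type*} [MeasurableSpace E] [MeasurableSpace F]
    {m mΩ : MeasurableSpace Ω} {P : Measure Ω} [IsProbabilityMeasure P]
    (hm : m ≤ mΩ) {X : Ω → E} {Y : Ω → F} (hX : Measurable[m] X) (hY : Measurable Y)
    (hind : Indep (MeasurableSpace.comap Y inferInstance) m P)
    {A : Set (E × F)} (hA : MeasurableSet A) :
    P⟦{ω | (X ω, Y ω) ∈ A} | m⟧
      =ᵐ[P] fun ω => (P.map Y).real (Prod.mk (X ω) ⁻¹' A) := by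
  have hX' : Measurable X := hX.mono hm le_rfl
  have : IsProbabilityMeasure (P.map Y) := Measure.isProbabilityMeasure_map hY.aemeasurable
  have hg : Measurable fun e => (P.map Y).real (Prod.mk e ⁻¹' A) :=
    (measurable_measure_prodMk_left hA).ennreal_toReal
  have hgX : Integrable (fun ω => (P.map Y).real (Prod.mk (X ω) ⁻¹' A)) P :=
    Integrable.of_bound (hg.comp hX').aestronglyMeasurable 1
      (.of_forall fun ω => by
      rw [Real.norm_of_nonneg measureReal_nonneg]; exact measureReal_le_one)
  have hAm : MeasurableSet {ω | (X ω, Y ω) ∈ A} := (hX'.prodMk hY) hA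
  symm
  refine ae_eq_condExp_of_forall_setIntegral_eq hm
    ((integrable_const (1 : ℝ)).indicator hAm) (fun _ _ _ => hgX.integrableOn) (fun B hB _ => ?_)
    (hg.comp hX).stronglyMeasurable.aestronglyMeasurable
  have hB' : MeasurableSet B := hm _ hB
  -- Carrying membership in the test event $B$ as an extra coordinate lets the product law of
  -- $(Z,Y)$ and Tonelli give the integral over $B$.
  let Z : Ω → E × Prop := fun ω => (X ω, ω ∈ B)
  have hZ : Measurable[m] Z := @Measurable.prodMk _ m _ _ _ _ _ _ hX (@MeasurableSet.mem _ _ m hB)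
  have hZ' : Measurable Z := hZ.mono hm le_rfl
  have hYZ : IndepFun Z Y P := by
    rw [IndepFun_iff_Indep]
    exact (indep_of_indep_of_le_right hind hZ.comap_le).symm
  have hlaw := (indepFun_iff_map_prod_eq_prod_map_map hZ'.aemeasurable hY.aemeasurable).1 hYZ
  let A' : Set ((E × Prop) × F) := {w | w.1.2 ∧ (w.1.1, w.2) ∈ A}
  have hA' : MeasurableSet A' := by
    have h1 : MeasurableSet {w : (E × Prop) × F | w.1.2} :=
      measurableSet_setOfPred.2 (measurable_snd.comp measurable_fst)
    have h2 : MeasurableSet {w : (E × Prop) × F | (w.1.1, w.2) ∈ A} :=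
      ((measurable_fst.comp measurable_fst).prodMk measurable_snd) hA
    exact h1.inter h2
  have key : P (B ∩ {ω | (X ω, Y ω) ∈ A}) = ∫⁻ ω in B, P.map Y (Prod.mk (X ω) ⁻¹' A) ∂P := by
    have h1 : P (B ∩ {ω | (X ω, Y ω) ∈ A}) = P.map (fun ω => (Z ω, Y ω)) A' := by
      rw [Measure.map_apply (hZ'.prodMk hY) hA']; rfl
    rw [h1, hlaw, Measure.prod_apply hA', lintegral_map (measurable_measure_prodMk_left hA') hZ',
      ← lintegral_indicator hB']
    refine lintegral_congr fun ω => ?_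
    by_cases hω : ω ∈ B
    · rw [Set.indicator_of_mem hω]
      congr 1; ext y; simp [A', Z, hω]
    · rw [Set.indicator_of_notMem hω]
      have : Prod.mk (Z ω) ⁻¹' A' = ∅ := by ext y; simp [A', Z, hω]
      rw [this, measure_empty]
  rw [setIntegral_indicator hAm, setIntegral_const, smul_eq_mul, mul_one, measureReal_def, key]
  simp only [measureReal_def]
  exact integral_toReal ((measurable_measure_prodMk_left hA).comp hX').aemeasurable
    (.of_forall fun ω => measure_lt_top _ _)

/-- Probability measures on `ℝ^d` with the same values on rational lower orthants agree. -/
lemma ext_of_Iic_rat {d : ℕ} {μ ν : Measure (Fin d → ℝ)} [IsProbabilityMeasure μ]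
    [IsProbabilityMeasure ν]
    (h : ∀ q : Fin d → ℚ, μ.real (Set.Iic fun i => (q i : ℝ)) = ν.real (Set.Iic fun i => (q i : ℝ))) :
    μ = ν := by
  refine MeasureTheory.ext_of_generate_finite
    (Set.pi Set.univ '' Set.pi Set.univ fun _ : Fin d => ⋃ a : ℚ, {Set.Iic (a : ℝ)})
    (generateFrom_eq_pi (fun _ => ?_) fun _ => ?_).symm
    (IsPiSystem.pi fun _ => Real.isPiSystem_Iic_rat) ?_ (by simp)
  · rw [← Real.borel_eq_generateFrom_Iic_rat]
    exact (BorelSpace.measurable_eq (α := ℝ)).symm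
  · refine ⟨fun n => Set.Iic ((n : ℚ) : ℝ), fun n => Set.mem_iUnion.2 ⟨n, rfl⟩, ?_⟩
    refine Set.eq_univ_of_forall fun r => ?_
    obtain ⟨n, hn⟩ := exists_nat_ge r
    exact Set.mem_iUnion.2 ⟨n, by simpa using hn⟩
  · rintro _ ⟨s, hs, rfl⟩
    have hs' : ∀ i, ∃ a : ℚ, Set.Iic (a : ℝ) = s i := fun i => by
      simpa using hs i (Set.mem_univ i)
    choose q hq using hs'
    have : Set.pi Set.univ s = Set.Iic fun i => (q i : ℝ) := by
      rw [← Set.pi_univ_Iic]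
      exact Set.pi_congr rfl fun i _ => (hq i).symm
    rw [this]
    exact (ENNReal.toReal_eq_toReal_iff' (measure_ne_top _ _) (measure_ne_top _ _)).1 (h q)

end Conditioning

/-! ### Gaussian regression and conditional distribution functions -/

section Regression

variable {Ω : Type*} {N d : ℕ}
  {x : Fin (N + 1) → Ω → (Fin d → ℝ)}

/-- The linear combination of the scalar components of the sequence with coefficients `u`. -/
def linComb (x : Fin (N + 1) → Ω → (Fin d → ℝ)) (u : Fin (N + 1) × Fin d → ℝ) (ω : Ω) : ℝ :=
  ∑ q, u q * x q.1 ω q.2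

lemma linComb_sub (u v : Fin (N + 1) × Fin d → ℝ) (ω : Ω) :
    linComb x (u - v) ω = linComb x u ω - linComb x v ω := by
  simp [linComb, sub_mul]

lemma linComb_single (k : Fin (N + 1)) (a : Fin d) (ω : Ω) :
    linComb x (Pi.single (k, a) 1) ω = x k ω a := by
  simp [linComb, Pi.single_apply]

lemma measurable_sigmaOf {S : Set (Fin (N + 1))} {i : Fin (N + 1)} (hi : i ∈ S) :
    Measurable[sigmaOf x S] (x i) :=
  Measurable.of_comap_le (le_iSup₂_of_le i hi le_rfl)

lemma measurable_linComb_sigmaOf {S : Set (Fin (N + 1))} {u : Fin (N + 1) × Fin d → ℝ}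
    (hu : ∀ q ∉ Prod.fst ⁻¹' S, u q = 0) : Measurable[sigmaOf x S] (linComb x u) := by
  refine Finset.measurable_sum _ fun q _ => ?_
  by_cases hq : q.1 ∈ S
  · exact measurable_const.mul ((measurable_pi_apply q.2).comp (measurable_sigmaOf hq))
  · simp only [hu q hq, zero_mul]
    exact measurable_const

variable [MeasurableSpace Ω] {P : Measure Ω}

lemma measurable_linComb (hx : IsNonsingularGaussian P x) (u : Fin (N + 1) × Fin d → ℝ) :
    Measurable (linComb x u) :=
  Finset.measurable_sum _ fun q _ =>
    measurable_const.mul ((measurable_pi_apply q.2).comp (hx.measurable q.1))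

lemma sigmaOf_le (hx : IsNonsingularGaussian P x) (S : Set (Fin (N + 1))) :
    sigmaOf x S ≤ (inferInstance : MeasurableSpace Ω) :=
  iSup₂_le fun i _ => (hx.measurable i).comap_le

lemma memLp_eval (hx : IsNonsingularGaussian P x) (q : Fin (N + 1) × Fin d) :
    MemLp (fun ω => x q.1 ω q.2) 2 P :=
  (hx.gaussian.eval q.1).memLp_two.eval q.2

lemma memLp_linComb (hx : IsNonsingularGaussian P x) (u : Fin (N + 1) × Fin d → ℝ) :
    MemLp (linComb x u) 2 P :=
  memLp_finsetSum _ fun q _ => (memLp_eval hx q).const_mul (u q)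

lemma hasGaussianLaw_linComb {α β : Type*} [Finite α] [Finite β] (hx : IsNonsingularGaussian P x)
    (u : α → Fin (N + 1) × Fin d → ℝ) (v : β → Fin (N + 1) × Fin d → ℝ) :
    HasGaussianLaw (fun ω => (fun a => linComb x (u a) ω, fun b => linComb x (v b) ω)) P := by
  have := Fintype.ofFinite α
  have := Fintype.ofFinite β
  let f (w : Fin (N + 1) × Fin d → ℝ) : (Fin (N + 1) → Fin d → ℝ) →L[ℝ] ℝ :=
    ∑ q : Fin (N + 1) × Fin d, w q •
      ((ContinuousLinearMap.proj (R := ℝ) (φ := fun _ : Fin d => ℝ) q.2).comp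
        (ContinuousLinearMap.proj (R := ℝ) (φ := fun _ : Fin (N + 1) => Fin d → ℝ) q.1))
  have hf : ∀ w ω, f w (fun k => x k ω) = linComb x w ω := fun w ω => by
    simp [f, linComb]
  have := hx.gaussian.map_fun
    ((ContinuousLinearMap.pi fun a => f (u a)).prod (ContinuousLinearMap.pi fun b => f (v b)))
  simpa [ContinuousLinearMap.prod_apply, ContinuousLinearMap.pi_apply, hf] using this

variable [IsProbabilityMeasure P]

open Matrix in
lemma covariance_linComb (hx : IsNonsingularGaussian P x) (u v : Fin (N + 1) × Fin d → ℝ) :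
    cov[linComb x u, linComb x v; P] = u ⬝ᵥ covMatrix P x *ᵥ v := by
  unfold linComb
  rw [covariance_fun_sum_fun_sum (fun q => (memLp_eval hx q).const_mul (u q))
    (fun q => (memLp_eval hx q).const_mul (v q))]
  simp only [covariance_const_mul_left, covariance_const_mul_right, dotProduct, mulVec,
    Finset.mul_sum, covMatrix, of_apply]
  exact Finset.sum_congr rfl fun q _ => Finset.sum_congr rfl fun r _ => by ring

open Matrix in
lemma posDef_covMatrix (hx : IsNonsingularGaussian P x) : (covMatrix P x).PosDef := by
  have h : (covMatrix P x).PosSemidef := by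
    refine .of_dotProduct_mulVec_nonneg ?_ fun u => ?_
    · ext p q
      simp only [conjTranspose_apply, covMatrix, of_apply, star_trivial]
      exact covariance_comm _ _
    · rw [star_trivial, ← covariance_linComb hx,
        covariance_self (memLp_linComb hx u).aemeasurable]
      exact variance_nonneg _ _
  exact h.posDef_iff_isUnit.2 ((isUnit_iff_isUnit_det _).2 hx.nonsingular)

open Matrix in
/-- A residual that is uncorrelated with the `x_i`, `i ∈ S`, is independent of them. -/
lemma indep_sigmaOf (hx : IsNonsingularGaussian P x) {α : Type*} [Finite α]
    {S : Set (Fin (N + 1))} {u : α → Fin (N + 1) × Fin d → ℝ}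
    (hu : ∀ a, ∀ q ∈ Prod.fst ⁻¹' S, (covMatrix P x *ᵥ u a) q = 0) :
    Indep (MeasurableSpace.comap (fun ω a => linComb x (u a) ω) inferInstance)
      (sigmaOf x S) P := by
  let v (q : (Prod.fst ⁻¹' S : Set (Fin (N + 1) × Fin d))) : Fin (N + 1) × Fin d → ℝ :=
    Pi.single q.1 1
  have h := (hasGaussianLaw_linComb hx u v).indepFun_of_covariance_eval fun a q => by
    rw [covariance_comm, covariance_linComb hx, single_one_dotProduct]
    exact hu a _ q.2
  rw [IndepFun_iff_Indep] at h
  refine indep_of_indep_of_le_right h (iSup₂_le fun i hi => ?_)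
  refine Measurable.comap_le (@measurable_pi_lambda _ _ _ (_) _ _ fun a => ?_)
  have : (fun ω => x i ω a) = (fun w : (Prod.fst ⁻¹' S : Set (Fin (N + 1) × Fin d)) → ℝ =>
      w ⟨(i, a), hi⟩) ∘ fun ω q => linComb x (v q) ω := by
    funext ω
    exact (linComb_single i a ω).symm
  rw [this]
  exact (measurable_pi_apply _).comp (comap_measurable _)

open Matrix in
/-- The conditional distribution function of `x_k` given the `x_i`, `i ∈ S`, in terms of the
regression of `x_k` with coefficients `h`. -/
lemma condExp_eq_of_regression (hx : IsNonsingularGaussian P x) {S : Set (Fin (N + 1))}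
    {k : Fin (N + 1)} {h : Fin d → Fin (N + 1) × Fin d → ℝ}
    (hS : ∀ a, ∀ q ∉ Prod.fst ⁻¹' S, h a q = 0)
    (hu : ∀ a, ∀ q ∈ Prod.fst ⁻¹' S, (covMatrix P x *ᵥ (Pi.single (k, a) 1 - h a)) q = 0)
    (ξ : Fin d → ℝ) :
    P⟦{ω | x k ω ≤ ξ} | sigmaOf x S⟧ =ᵐ[P] fun ω =>
      (P.map fun ω a => linComb x (Pi.single (k, a) 1 - h a) ω).real
        {r | (fun a => linComb x (h a) ω) + r ≤ ξ} := by
  have hA : MeasurableSet {w : (Fin d → ℝ) × (Fin d → ℝ) | w.1 + w.2 ≤ ξ} :=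
    (measurable_fst.add measurable_snd) measurableSet_Iic
  have := condExp_indicator_prod_of_indep (P := P) (sigmaOf_le hx S)
    (X := fun ω a => linComb x (h a) ω) (Y := fun ω a => linComb x (Pi.single (k, a) 1 - h a) ω)
    (@measurable_pi_lambda _ _ _ (_) _ _ fun a => measurable_linComb_sigmaOf (hS a))
    (@measurable_pi_lambda _ _ _ (_) _ _ fun a => measurable_linComb hx _) (indep_sigmaOf hx hu) hA
  convert this using 4 with ω
  swap
  · rfl
  ext ω
  have : x k ω = (fun a => linComb x (h a) ω) +
      fun a => linComb x (Pi.single (k, a) 1 - h a) ω := by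
    funext a
    simp [linComb_sub, linComb_single]
  simp only [Set.mem_ofPred_eq, this]

open Matrix in
-- Equal conditional laws have equal means, which forces the two regressions to coincide.
-- Conversely, coefficients supported on $T$ with residual orthogonal to $S$ represent both
-- conditional probabilities.
lemma condExp_eq_iff_isExplained (hx : IsNonsingularGaussian P x) {S T : Set (Fin (N + 1))}
    (hTS : T ⊆ S) (k : Fin (N + 1)) :
    (∀ ξ : Fin d → ℝ, P⟦{ω | x k ω ≤ ξ} | sigmaOf x S⟧ =ᵐ[P] P⟦{ω | x k ω ≤ ξ} | sigmaOf x T⟧) ↔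
      ∀ a : Fin d, IsExplained (covMatrix P x) (Prod.fst ⁻¹' S) (Prod.fst ⁻¹' T) (k, a) := by
  have hC := posDef_covMatrix hx
  constructor
  · intro H
    choose f hf hf' using fun a : Fin d =>
      exists_projection hC (Prod.fst ⁻¹' S) (Pi.single (k, a) 1)
    choose g hg hg' using fun a : Fin d =>
      exists_projection hC (Prod.fst ⁻¹' T) (Pi.single (k, a) 1)
    -- Rational thresholds are countable, so one null set serves them all.
    have hae : ∀ᵐ ω ∂P, ∀ q : Fin d → ℚ,
        (P.map fun ω a => linComb x (Pi.single (k, a) 1 - f a) ω).real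
          {r | (fun a => linComb x (f a) ω) + r ≤ fun i => (q i : ℝ)} =
        (P.map fun ω a => linComb x (Pi.single (k, a) 1 - g a) ω).real
          {r | (fun a => linComb x (g a) ω) + r ≤ fun i => (q i : ℝ)} := by
      refine ae_all_iff.2 fun q => ?_
      filter_upwards [H fun i => (q i : ℝ), condExp_eq_of_regression hx hf hf' fun i => (q i : ℝ),
        condExp_eq_of_regression hx hg hg' fun i => (q i : ℝ)] with ω h1 h2 h3
      rw [← h2, h1, h3]
    have hmean : ∀ a, ∀ᵐ ω ∂P, linComb x (f a - g a) ω =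
        P[linComb x (Pi.single (k, a) 1 - g a)] - P[linComb x (Pi.single (k, a) 1 - f a)] := by
      intro a
      filter_upwards [hae] with ω hω
      have hR : ∀ u : Fin d → Fin (N + 1) × Fin d → ℝ, Measurable fun ω a => linComb x (u a) ω :=
        fun u => measurable_pi_iff.2 fun a => measurable_linComb hx _
      have hadd : ∀ c : Fin d → ℝ, Measurable fun r : Fin d → ℝ => c + r := fun c =>
        measurable_const.add measurable_id
      have hint : ∀ u : Fin d → Fin (N + 1) × Fin d → ℝ, ∀ c : Fin d → ℝ,
          ∫ r, r a ∂((P.map fun ω a => linComb x (u a) ω).map fun r => c + r)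
            = c a + P[linComb x (u a)] := by
        intro u c
        rw [integral_map (hadd c).aemeasurable (measurable_pi_apply a).aestronglyMeasurable,
          integral_map (hR u).aemeasurable
            (f := fun r : Fin d → ℝ => (c + r) a)
            ((measurable_pi_apply a).comp (hadd c)).aestronglyMeasurable]
        simp only [Pi.add_apply]
        rw [integral_add (integrable_const _) ((memLp_linComb hx _).integrable (by norm_num))]
        simp
      have hp : ∀ u : Fin d → Fin (N + 1) × Fin d → ℝ, ∀ c : Fin d → ℝ, IsProbabilityMeasure
          ((P.map fun ω a => linComb x (u a) ω).map fun r => c + r) := fun u c => by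
        have := Measure.isProbabilityMeasure_map (μ := P) (hR u).aemeasurable
        exact Measure.isProbabilityMeasure_map (hadd c).aemeasurable
      have hext : ((P.map fun ω a => linComb x (Pi.single (k, a) 1 - f a) ω).map
            fun r => (fun a => linComb x (f a) ω) + r) =
          ((P.map fun ω a => linComb x (Pi.single (k, a) 1 - g a) ω).map
            fun r => (fun a => linComb x (g a) ω) + r) := by
        have := hp (fun a => Pi.single (k, a) 1 - f a) fun a => linComb x (f a) ω
        have := hp (fun a => Pi.single (k, a) 1 - g a) fun a => linComb x (g a) ω
        refine ext_of_Iic_rat fun q => ?_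
        rw [map_measureReal_apply (hadd _) measurableSet_Iic,
          map_measureReal_apply (hadd _) measurableSet_Iic]
        exact hω q
      have h1 := hint (fun a => Pi.single (k, a) 1 - f a) fun a => linComb x (f a) ω
      have h2 := hint (fun a => Pi.single (k, a) 1 - g a) fun a => linComb x (g a) ω
      rw [hext, h2] at h1
      rw [linComb_sub]
      linarith
    intro a
    -- An almost surely constant combination has variance zero, so positive definiteness kills its
    -- coefficients.
    have hfg : f a - g a = 0 := by
      by_contra hne
      have h0 := hC.dotProduct_mulVec_pos hne
      rw [star_trivial, ← covariance_linComb hx, covariance_self (memLp_linComb hx _).aemeasurable,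
        variance_congr (hmean a)] at h0
      rw [← covariance_self aemeasurable_const, covariance_const_left] at h0
      exact lt_irrefl _ h0
    refine ⟨g a, hg a, ?_⟩
    rw [← sub_eq_zero.1 hfg]
    exact hf' a
  · intro H ξ
    choose h hT hS using H
    exact (condExp_eq_of_regression hx (fun a q hq => hT a q fun hq' => hq (hTS hq')) hS ξ).trans
      (condExp_eq_of_regression hx hT (fun a q hq => hS a q (hTS hq)) ξ).symm

end Regression
-- The CM properties as zero patterns of the inverse covariance
section Main

variable {Ω : Type*} [MeasurableSpace Ω] {N d : ℕ} {P : Measure Ω} [IsProbabilityMeasure P]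
  {x : Fin (N + 1) → Ω → (Fin d → ℝ)}

/-- The conditioning set is rewritten as a disjoint union $P\cup J$, with $c$ removed from the past,
to fit the criteria on $C^{-1}$. -/
lemma isCM_iff_isExplained (hx : IsNonsingularGaussian P x) {k₁ k₂ c : Fin (N + 1)}
    (hc : c = k₁ ∨ c = k₂) :
    IsCM P x k₁ k₂ c ↔ ∀ j k : Fin (N + 1), k₁ ≤ j → j < k → k ≤ k₂ → ∀ a : Fin d,
      IsExplained (covMatrix P x) (Prod.fst ⁻¹' (Set.Ico k₁ j \ {c}) ∪ Prod.fst ⁻¹' {j, c})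
        (Prod.fst ⁻¹' {j, c}) (k, a) := by
  refine forall₅_congr fun j k hj hjk hk => ?_
  rw [condExp_eq_iff_isExplained hx (by rintro i (rfl | rfl) <;> simp [hj])]
  have : Set.Icc k₁ j ∪ {c} = (Set.Ico k₁ j \ {c}) ∪ {j, c} := by
    ext i
    simp only [Set.mem_union, Set.mem_Icc, Set.mem_singleton_iff, Set.mem_sdiff, Set.mem_Ico,
      Set.mem_insert_iff]
    constructor
    · rintro (⟨h1, h2⟩ | h)
      · by_cases hi : i = c
        · exact .inr (.inr hi)
        · rcases h2.lt_or_eq with h2 | h2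
          · exact .inl ⟨⟨h1, h2⟩, hi⟩
          · exact .inr (.inl h2)
      · exact .inr (.inr h)
    · rintro (⟨⟨h1, h2⟩, _⟩ | rfl | h)
      · exact .inl ⟨h1, h2.le⟩
      · exact .inl ⟨hj, le_rfl⟩
      · exact .inr h
  rw [this, Set.preimage_union]

/-- The `CM_L` property in terms of the inverse covariance matrix. -/
lemma isCML_iff (hx : IsNonsingularGaussian P x) :
    IsCML P x 0 (Fin.last N) ↔ ∀ i j k : Fin (N + 1), i < j → j < k → k < Fin.last N →
      ∀ a b : Fin d, (covMatrix P x)⁻¹ (i, a) (k, b) = 0 := by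
  have hC := posDef_covMatrix hx
  rw [IsCML, isCM_iff_isExplained hx (.inr rfl)]
  constructor
  · intro H i j k hij hjk hk a b
    refine inv_eq_zero_of_isExplained hC (O := ∅)
      (P := Prod.fst ⁻¹' (Set.Ico 0 j \ {Fin.last N})) (J := Prod.fst ⁻¹' {j, Fin.last N})
      (F := Prod.fst ⁻¹' (Set.Ioo j (Fin.last N))) ?_ ?_ ?_ ?_ ?_ ?_ ?_ ?_ ?_ ?_
    · rintro ⟨q, _⟩
      have := Fin.le_last q
      simp only [Set.mem_preimage, Set.mem_sdiff, Set.mem_Ico, Set.mem_singleton_iff,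
        Set.mem_insert_iff, Set.mem_Ioo, Set.mem_empty_iff_false, Fin.zero_le]
      grind
    · refine Disjoint.preimage _ (Set.disjoint_left.2 fun q h1 h2 => ?_)
      rcases h2 with rfl | h2
      · exact lt_irrefl _ h1.1.2
      · exact h1.2 h2
    · exact Disjoint.preimage _ (Set.disjoint_left.2 fun q h1 h2 => lt_asymm h1.1.2 h2.1)
    · exact Set.empty_disjoint _
    · exact Set.empty_disjoint _
    · refine Disjoint.preimage _ (Set.disjoint_left.2 fun q h1 h2 => ?_)
      rcases h1 with rfl | rfl
      · exact lt_irrefl _ h2.1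
      · exact lt_irrefl _ h2.2
    · rintro _ _ _ ⟨⟩
    · rintro ⟨q, c⟩ hq
      exact H j q (Fin.zero_le _) hq.1 (Fin.le_last _) c
    · exact ⟨⟨Fin.zero_le _, hij⟩, (hij.trans (hjk.trans hk)).ne⟩
    · exact ⟨hjk, hk⟩
  · intro H j k _ hjk _ a
    -- For $k=N$ the variable is itself among those conditioned on.
    rcases (Fin.le_last k).eq_or_lt with rfl | hk
    · exact isExplained_of_mem _ _ (by simp)
    · refine isExplained_of_inv_eq_zero hC ?_ fun h => lt_asymm h.1.2 hjk
      rintro ⟨p, b⟩ hp ⟨q, c⟩ hqP hqJ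
      have hq : j < q ∧ q < Fin.last N := by
        have := Fin.le_last q
        simp only [Set.mem_preimage, Set.mem_sdiff, Set.mem_Ico, Set.mem_singleton_iff,
          Set.mem_insert_iff, Fin.zero_le] at hqP hqJ
        grind
      exact H p j q hp.1.2 hq.1 hq.2 b c

/-- For a `CM_L` sequence, the `[k₁,N]`-`CM_F` property in terms of the inverse covariance
matrix. -/
lemma isCMF_iff (hx : IsNonsingularGaussian P x) {k₁ : Fin (N + 1)}
    (hL : ∀ i j k : Fin (N + 1), i < j → j < k → k < Fin.last N →
      ∀ a b : Fin d, (covMatrix P x)⁻¹ (i, a) (k, b) = 0) :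
    IsCMF P x k₁ (Fin.last N) ↔ ∀ i j k : Fin (N + 1), k₁ < i → i < j → j < k →
      ∀ a b : Fin d, (covMatrix P x)⁻¹ (i, a) (k, b) = 0 := by
  have hC := posDef_covMatrix hx
  have hsymm : ∀ p q, (covMatrix P x)⁻¹ p q = (covMatrix P x)⁻¹ q p := fun p q => by
    simpa using (hC.inv.isHermitian.apply p q).symm
  have hPO : ∀ j : Fin (N + 1), ∀ p : Fin (N + 1) × Fin d,
      p ∈ (Prod.fst ⁻¹' (Set.Ico k₁ j \ {k₁}) : Set (Fin (N + 1) × Fin d)) →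
      ∀ q : Fin (N + 1) × Fin d, q ∈ (Prod.fst ⁻¹' Set.Iio k₁ : Set (Fin (N + 1) × Fin d)) →
      (covMatrix P x)⁻¹ p q = 0 := by
    rintro j ⟨p, b⟩ ⟨⟨h1, h2⟩, h3⟩ ⟨q, c⟩ hq
    rw [hsymm]
    exact hL q k₁ p hq (lt_of_le_of_ne h1 fun h => h3 h.symm)
      (h2.trans_le (Fin.le_last _)) c b
  rw [IsCMF, isCM_iff_isExplained hx (.inl rfl)]
  constructor
  · intro H i j k hi hij hjk a b
    refine inv_eq_zero_of_isExplained hC (O := Prod.fst ⁻¹' Set.Iio k₁)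
      (P := Prod.fst ⁻¹' (Set.Ico k₁ j \ {k₁})) (J := Prod.fst ⁻¹' {j, k₁})
      (F := Prod.fst ⁻¹' (Set.Ioi j)) ?_ ?_ ?_ ?_ ?_ ?_ (hPO j) ?_ ?_ ?_
    · rintro ⟨q, _⟩
      simp only [Set.mem_preimage, Set.mem_sdiff, Set.mem_Ico, Set.mem_singleton_iff,
        Set.mem_insert_iff, Set.mem_Ioi, Set.mem_Iio]
      grind
    · refine Disjoint.preimage _ (Set.disjoint_left.2 fun q h1 h2 => ?_)
      rcases h2 with rfl | h2
      · exact lt_irrefl _ h1.1.2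
      · exact h1.2 h2
    · exact Disjoint.preimage _ (Set.disjoint_left.2 fun q h1 h2 => lt_asymm h1.1.2 h2)
    · exact Disjoint.preimage _ (Set.disjoint_left.2 fun q h1 h2 => not_lt.2 h2.1.1 h1)
    · refine Disjoint.preimage _ (Set.disjoint_left.2 fun q h1 h2 => ?_)
      rcases h2 with rfl | rfl
      · exact lt_asymm h1 (hi.trans hij)
      · exact lt_irrefl q h1
    · refine Disjoint.preimage _ (Set.disjoint_left.2 fun q h1 h2 => ?_)
      rcases h1 with rfl | rfl
      · exact lt_irrefl q h2
      · exact lt_asymm h2 (hi.trans hij)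
    · rintro ⟨q, c⟩ hq
      exact H j q (hi.trans hij).le hq (Fin.le_last _) c
    · exact ⟨⟨hi.le, hij⟩, hi.ne'⟩
    · exact hjk
  · intro H j k hj hjk _ a
    refine isExplained_of_inv_eq_zero hC ?_ fun h => lt_asymm h.1.2 hjk
    rintro ⟨p, b⟩ hp ⟨q, c⟩ hqP hqJ
    -- Times before $k_1$ also lie outside $P\cup J$; only $CM_L$ controls them.
    rcases lt_or_ge q k₁ with hq | hq
    · exact hPO j _ hp _ hq
    · have hq : j < q := by
        simp only [Set.mem_preimage, Set.mem_sdiff, Set.mem_Ico, Set.mem_singleton_iff,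
          Set.mem_insert_iff] at hqP hqJ
        grind
      exact H p j q (lt_of_le_of_ne hp.1.1 fun h => hp.2 h.symm) hp.1.2 hq b c

/-- A symmetric matrix whose blocks vanish off the tridiagonal band and the last block row and
column is of the form `cmLForm`. -/
lemma eq_comp_cmLForm {M : Matrix (Fin (N + 1) × Fin d) (Fin (N + 1) × Fin d) ℝ}
    (hsymm : ∀ p q, M p q = M q p)
    (hM : ∀ i j k : Fin (N + 1), i < j → j < k → k < Fin.last N →
      ∀ a b : Fin d, M (i, a) (k, b) = 0) :
    let block : ℕ → ℕ → Matrix (Fin d) (Fin d) ℝ := fun i j =>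
      Matrix.of fun a b => M (Fin.ofNat (N + 1) i, a) (Fin.ofNat (N + 1) j, b)
    M = Matrix.comp (Fin (N + 1)) (Fin (N + 1)) (Fin d) (Fin d) ℝ
      (cmLForm N (fun i => block i i) (fun i => block i (i + 1)) fun i => block i N) := by
  intro block
  have hblock : ∀ i j : Fin (N + 1), ∀ a b, block i j a b = M (i, a) (j, b) := fun i j a b => by
    simp [block]
  have hzero : ∀ i k : Fin (N + 1), i.val + 1 < k.val → k.val ≠ N → ∀ a b,
      M (i, a) (k, b) = 0 := fun i k h1 h2 a b =>
    hM i ⟨i.val + 1, by omega⟩ k (Fin.lt_def.2 (Nat.lt_succ_self _)) (Fin.lt_def.2 h1)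
      (Fin.lt_def.2 (by rw [Fin.val_last]; omega)) a b
  ext ⟨i, a⟩ ⟨j, b⟩
  rw [Matrix.comp_apply]
  simp only [cmLForm, Matrix.of_apply]
  split_ifs with h1 h2 h3 h4 h5
  · rw [show M (i, a) (j, b) = block i j a b from (hblock i j a b).symm, h1]
  · rw [show M (i, a) (j, b) = block i j a b from (hblock i j a b).symm, h2]
  · rw [Matrix.transpose_apply, hsymm, ← hblock j i b a, h3]
  · rw [show M (i, a) (j, b) = block i j a b from (hblock i j a b).symm, h4]
  · rw [Matrix.transpose_apply, hsymm, ← hblock j i b a, h5]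
  · rw [Matrix.zero_apply]
    rcases lt_or_gt_of_ne h1 with h | h
    · exact hzero i j (by omega) h4 a b
    · rw [hsymm]
      exact hzero j i (by omega) h5 b a

end Main
end CMSequence

theorem mainTheorem7 {Ω : Type*} [MeasurableSpace Ω] (P : Measure Ω) [IsProbabilityMeasure P]
    (N d : ℕ) (x : Fin (N + 1) → Ω → (Fin d → ℝ))
    (hx : CMSequence.IsNonsingularGaussian P x)
    (k₁ : Fin (N + 1)) (hk₁ : k₁ < Fin.last N) :
    (CMSequence.IsCML P x 0 (Fin.last N) ∧ CMSequence.IsCMF P x k₁ (Fin.last N)) ↔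
      ∃ A B D : ℕ → Matrix (Fin d) (Fin d) ℝ,
        (CMSequence.covMatrix P x)⁻¹ =
            Matrix.comp (Fin (N + 1)) (Fin (N + 1)) (Fin d) (Fin d) ℝ
              (CMSequence.cmLForm N A B D) ∧
          ∀ k : ℕ, k₁.val + 1 ≤ k → k + 2 ≤ N → D k = 0 := by
  rw [CMSequence.isCML_iff hx, and_congr_right fun hL => CMSequence.isCMF_iff hx (k₁ := k₁) hL]
  constructor
  · rintro ⟨hL, hF⟩
    refine ⟨_, _, _, CMSequence.eq_comp_cmLForm (fun p q => ?_) hL, fun k hk hkN => ?_⟩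
    · simpa using ((CMSequence.posDef_covMatrix hx).inv.isHermitian.apply p q).symm
    · ext a b
      -- $D_k$ is the block $(k,N)$; the bound $k+2\le N$ puts $k+1$ strictly between.
      refine hF (Fin.ofNat (N + 1) k) (Fin.ofNat (N + 1) (k + 1)) (Fin.ofNat (N + 1) N)
        ?_ ?_ ?_ a b <;>
      · rw [Fin.lt_def]
        simp only [Fin.val_ofNat, Nat.mod_eq_of_lt (show k < N + 1 by omega),
          Nat.mod_eq_of_lt (show k + 1 < N + 1 by omega),
          Nat.mod_eq_of_lt (show N < N + 1 by omega)]
        omega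
  · rintro ⟨A, B, D, h, hD⟩
    rw [h]
    refine ⟨fun i j k hij hjk hk a b => ?_, fun i j k hi hij hjk a b => ?_⟩
    · rw [Fin.lt_def] at hij hjk hk
      rw [Fin.val_last] at hk
      rw [Matrix.comp_apply]
      simp only [CMSequence.cmLForm, Matrix.of_apply]
      rw [if_neg (by omega), if_neg (by omega), if_neg (by omega), if_neg (by omega),
        if_neg (by omega), Matrix.zero_apply]
    · rw [Fin.lt_def] at hi hij hjk
      have hkN := k.is_lt
      rw [Matrix.comp_apply]
      simp only [CMSequence.cmLForm, Matrix.of_apply]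
      rw [if_neg (by omega), if_neg (by omega), if_neg (by omega), hD i (by omega) (by omega),
        if_neg (by omega : i.val ≠ N), ite_self, Matrix.zero_apply]
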